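/- Let $G$ be a countable discrete abelian group (written additively), $\widehat G$ its compact dual group with Haar probability measure, and $x\mapsto\widehat x$, $\widehat x(\xi)=\sum_{g\in G}x(g)\overline{\xi(g)}$, the (Plancherel) Fourier transform $\ell^2(G)\to L^2(\widehat G)$. Let $g\mapsto U(g)$ be a unitary representation of $G$ on a separable complex Hilbert space $\mathcal H$, and let $\varphi_1,\dots,\varphi_N\in\mathcal H$ be such that $\{U(g)\varphi_n\}_{g\in G,\,1\le n\le N}$ is a Riesz sequence in $\mathcal H$. Put $\mathcal V_\Phi=\overline{\operatorname{span}}\{U(g)\varphi_n\}_{g\in G,\,1\le n\le N}$, and write $\ell^2_K(G)=\ell^2(G)^K$. Every $f\in\mathcal V_\Phi$ has a unique expansion $f=\sum_{n=1}^N\sum_{g\in G}x_n(g)\,U(g)\varphi_n$ with $\mathbf x=(x_1,\dots,x_N)^\top\in\ell^2_N(G)$. Let $A=[a_{m,n}]$ be an $M\times N$ matrix with entries in $\ell^2(G)$ whose transfer matrix $\widehat A=[\widehat a_{m,n}]$ has all its entries in $L^\infty(\widehat G)$. Define the samples of $f\in\mathcal V_\Phi$ by $$\boldsymbol{\mathcal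 L}f(g)=(\mathcal L_1f(g),\dots,\mathcal L_Mf(g))^\top=(A*\mathbf x)(g)=\sum_{g'\in G}A(g-g')\,\mathbf x(g'),\qquad g\in G .$$ Then the following statements are equivalent: (a) $\operatorname{ess\,inf}_{\xi\in\widehat G}\det[\widehat A(\xi)^*\widehat A(\xi)]>0$. (b) There exist constants $0<\alpha\le\beta$ such that $\alpha\|f\|^2\le\sum_{m=1}^M\sum_{g\in G}|\mathcal L_mf(g)|^2\le\beta\|f\|^2$ for all $f\in\mathcal V_\Phi$. (c) There exists an $N\times M$ matrix $\widehat B$ with entries in $L^\infty(\widehat G)$ such that $\widehat B(\xi)\widehat A(\xi)=I_N$ for a.e. $\xi\in\widehat G$. (d) There exists an $N\times M$ matrix $B$ with entries in $\ell^2(G)$, with $\widehat B$ having entries in $L^\infty(\widehat G)$, such that for every $f=\sum_{n}\sum_{g}x_n(g)U(g)\varphi_n\in\mathcal V_\Phi$ one has $\mathbf x=B*\boldsymbol{\mathcal L}f$. In other words (also equivalent): with $\mathcal A\mathbf x=A*\mathbf x$ the bounded convolution operator $\ell^2_N(G)\to\ell^2_M(G)$ associated with $A$, there exists a bounded convolution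 system $\mathcal B:\ell^2_M(G)\to\ell^2_N(G)$, that is, a bounded operator $\mathcal B\mathbf y=B*\mathbf y$ with $B$ over $\ell^2(G)$ and $\widehat B$ over $L^\infty(\widehat G)$, such that $\mathcal B\mathcal A=I_{\ell^2_N(G)}$. (e) There exist $S_1,\dots,S_M\in\mathcal V_\Phi$ such that $\{U(g)S_m\}_{g\in G,\,1\le m\le M}$ is a frame for $\mathcal V_\Phi$ and, for each $f\in\mathcal V_\Phi$, $f=\sum_{m=1}^M\sum_{g\in G}\mathcal L_mf(g)\,U(g)S_m$ in $\mathcal H$. (f) There exists a frame $\{S_{g,m}\}_{g\in G,\,1\le m\le M}$ for $\mathcal V_\Phi$ such that, for each $f\in\mathcal V_\Phi$, $f=\sum_{m=1}^M\sum_{g\in G}\mathcal L_mf(g)\,S_{g,m}$ in $\mathcal H$. In this case, any elements $S_1,\dots,S_M$ as in (e) are necessarily obtained from the columns of a left inverse as in (c): there is an $N\times M$ matrix $B=[b_{n,m}]$ with entries in $\ell^2(G)$, with $\widehat B$ having entries in $L^\infty(\widehat G)$ and $\widehat B(\xi)\widehat A(\xi)=I_N$ for a.e. $\xi$, such that $S_m=\sum_{n=1}^N\sum_{g\in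 G}b_{n,m}(g)\,U(g)\varphi_n$ for $m=1,\dots,M$. -/

import Mathlib

open MeasureTheory
open scoped ENNReal ComplexConjugate Matrix

noncomputable section

namespace ConvSampling

/-! ### The dual group and its Haar probability measure -/

/-- The dual group of the additive discrete group `G`: the compact group of all (continuous)
characters `ξ : G → 𝕋`. -/
abbrev DualGroup (G : Type*) [AddCommGroup G] [TopologicalSpace G] : Type _ :=
  PontryaginDual (Multiplicative G)

section Dual

variable (G : Type*) [AddCommGroup G] [TopologicalSpace G]

instance : MeasurableSpace (DualGroup G) := borel _

instance : BorelSpace (DualGroup G) := ⟨rfl⟩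

variable {G} in
/-- The pairing `⟨g, ξ⟩ = ξ(g)`, as a complex number of modulus one. -/
def pairing (g : G) (ξ : DualGroup G) : ℂ := (ξ (Multiplicative.ofAdd g) : Circle)

variable {G} in
theorem continuous_pairing (g : G) : Continuous (pairing g) := by
  have h : Continuous fun ξ : (Multiplicative G →ₜ* Circle) => ξ (Multiplicative.ofAdd g) :=
    ((continuous_eval_const (F := C(Multiplicative G, Circle))
      (Multiplicative.ofAdd g)).comp
      (ContinuousMonoidHom.isInducing_toContinuousMap (Multiplicative G) Circle).continuous)
  exact continuous_subtype_val.comp h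

variable [DiscreteTopology G]

/-- The Haar measure on the compact dual group, normalized to have total mass one. -/
def dualHaar : Measure (DualGroup G) := Measure.haarMeasure ⊤

instance : (dualHaar G).IsHaarMeasure := by unfold dualHaar; infer_instance

instance : IsProbabilityMeasure (dualHaar G) :=
  ⟨by simpa [dualHaar] using Measure.haarMeasure_self (K₀ := (⊤ : TopologicalSpace.PositiveCompacts (DualGroup G)))⟩

variable {G} in
/-- The function `ξ ↦ conj ⟨g, ξ⟩` on the dual group, as an element of `L²`. -/
def charLp (g : G) : Lp ℂ 2 (dualHaar G) :=
  ContinuousMap.toLp (E := ℂ) 2 (dualHaar G) ℂ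
    ⟨fun ξ => conj (pairing g ξ), Complex.continuous_conj.comp (continuous_pairing g)⟩

variable {G} in
/-- Characters separate the points of a discrete abelian group. -/
theorem exists_pairing_ne_one {g : G} (hg : g ≠ 0) : ∃ ξ : DualGroup G, pairing g ξ ≠ 1 := by
  obtain ⟨c, hc⟩ := CharacterModule.exists_character_apply_ne_zero_of_ne_zero hg
  let c' : G →+ AddCircle (1 : ℚ) := c
  let F : AddCircle (1 : ℚ) →+ AddCircle (1 : ℝ) :=
    QuotientAddGroup.map (AddSubgroup.zmultiples (1 : ℚ)) (AddSubgroup.zmultiples (1 : ℝ))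
      (Rat.castHom ℝ).toAddMonoidHom (by
        rw [AddSubgroup.zmultiples_le]
        exact AddSubgroup.mem_comap.2
          (AddSubgroup.mem_zmultiples_iff.2 ⟨1, by simp⟩))
  have hF : ∀ q, F q = 0 → q = 0 := by
    intro q
    induction q using QuotientAddGroup.induction_on with
    | H r =>
      intro h
      have h' : ((r : ℝ) : AddCircle (1 : ℝ)) = 0 := h
      obtain ⟨n, hn⟩ := (AddCircle.coe_eq_zero_iff (1 : ℝ)).1 h'
      refine (AddCircle.coe_eq_zero_iff (1 : ℚ)).2 ⟨n, ?_⟩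
      have : (n : ℝ) = (r : ℝ) := by simpa using hn
      simpa using (by exact_mod_cast this : (n : ℚ) = r)
  let ξ : Multiplicative G →ₜ* Circle :=
    { toFun := fun a => AddCircle.toCircle (F (c' a.toAdd))
      map_one' := by simp
      map_mul' := fun a b => by simp [AddCircle.toCircle_add]
      continuous_toFun := continuous_of_discreteTopology }
  refine ⟨ξ, fun h => hc (hF _ (AddCircle.injective_toCircle one_ne_zero ?_))⟩
  rw [AddCircle.toCircle_zero]
  exact Circle.coe_injective (h.trans Circle.coe_one.symm)

variable {G} in
theorem integral_pairing {g : G} (hg : g ≠ 0) : ∫ ξ, pairing g ξ ∂(dualHaar G) = 0 := by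
  obtain ⟨η, hη⟩ := exists_pairing_ne_one hg
  have h1 : ∫ ξ, pairing g (η * ξ) ∂(dualHaar G) = ∫ ξ, pairing g ξ ∂(dualHaar G) :=
    integral_mul_left_eq_self (pairing g) η
  have h2 : ∀ ξ, pairing g (η * ξ) = pairing g η * pairing g ξ := fun ξ => by
    have : (η * ξ) (Multiplicative.ofAdd g)
        = η (Multiplicative.ofAdd g) * ξ (Multiplicative.ofAdd g) := rfl
    simp [pairing, this]
  simp only [h2, integral_const_mul] at h1
  by_contra h
  exact hη (mul_right_cancel₀ h (h1.trans (one_mul _).symm))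

theorem orthonormal_charLp : Orthonormal ℂ (charLp : G → Lp ℂ 2 (dualHaar G)) := by
  classical
  rw [orthonormal_iff_ite]
  intro g h
  have key : ∀ ξ : DualGroup G,
      conj (pairing h ξ) * conj (conj (pairing g ξ)) = pairing (g - h) ξ := fun ξ => by
    simp only [pairing, ofAdd_sub, map_div, Complex.conj_conj, Circle.coe_div]
    rw [← Circle.coe_inv_eq_conj, mul_comm, Circle.coe_inv, div_eq_mul_inv]
  simp only [charLp, ContinuousMap.inner_toLp, ContinuousMap.coe_mk, key]
  split_ifs with hgh
  · subst hgh
    simp [pairing]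
  · exact integral_pairing (sub_ne_zero.2 hgh)

/-! ### The Fourier transform -/

/-- The space `ℓ²(G)` of square summable complex sequences. -/
abbrev EllTwo (G : Type*) : Type _ := lp (fun _ : G => ℂ) 2

/-- The Fourier (Plancherel) transform `ℓ²(G) → L²(Ĝ)`, `x ↦ ∑ g, x g • conj ⟨g, ·⟩`, the series
converging in `L²(Ĝ)`: the unique bounded extension of the transform of finitely supported (or of
summable) sequences. -/
def fourierL2 : EllTwo G →ₗᵢ[ℂ] Lp ℂ 2 (dualHaar G) :=
  (orthonormal_charLp G).orthogonalFamily.linearIsometry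

variable {G} in
theorem hasSum_fourierL2 (x : EllTwo G) :
    HasSum (fun g => x g • charLp g) (fourierL2 G x) :=
  (orthonormal_charLp G).orthogonalFamily.hasSum_linearIsometry x

end Dual

/-! ### Convolution systems -/

/-- The product Hilbert space `ℓ²_N(G) = ℓ²(G) × ⋯ × ℓ²(G)` (`N` times). -/
abbrev EllTwoN (G : Type*) (N : ℕ) : Type _ := PiLp 2 (fun _ : Fin N => EllTwo G)

/-- Matrices with entries in `ℓ²(G)`. -/
abbrev EllTwoMatrix (G : Type*) (M N : ℕ) : Type _ := Matrix (Fin M) (Fin N) (EllTwo G)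

section Convolution

variable {G : Type*} [AddCommGroup G] {M N : ℕ}

/-- The matrix convolution `(A * x)(g) = ∑ g', A(g - g') x(g')`, entry by entry. -/
def matConv (A : EllTwoMatrix G M N) (x : Fin N → G → ℂ) (m : Fin M) (g : G) : ℂ :=
  ∑ n, ∑' g', A m n (g - g') * x n g'

variable [TopologicalSpace G] [DiscreteTopology G]

/-- The transfer matrix `Â(ξ)`, with entries the Fourier transforms of the entries of `A`. -/
def transfer (A : EllTwoMatrix G M N) (ξ : DualGroup G) : Matrix (Fin M) (Fin N) ℂ :=
  Matrix.of fun m n => fourierL2 G (A m n) ξ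

/-- All the entries of `Â` belong to `L^∞(Ĝ)`. -/
def TransferBounded (A : EllTwoMatrix G M N) : Prop :=
  ∀ m n, MemLp (fourierL2 G (A m n)) ∞ (dualHaar G)

/-- The operator `T` is `x ↦ A * x`. -/
def IsConvolutionBy (T : EllTwoN G N →L[ℂ] EllTwoN G M) (A : EllTwoMatrix G M N) : Prop :=
  ∀ x m g, T x m g = matConv A (fun n => x n) m g

/-- Bounded convolution systems: the bounded operators of the form `x ↦ B * x`, where the matrix
`B` over `ℓ²(G)` has a transfer matrix with entries in `L^∞(Ĝ)`. -/
def IsBoundedConvolutionSystem (T : EllTwoN G N →L[ℂ] EllTwoN G M) : Prop :=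
  ∃ B : EllTwoMatrix G M N, TransferBounded B ∧ IsConvolutionBy T B

end Convolution

/-! ### Riesz sequences and frames -/

section Frames

variable {H : Type*} [NormedAddCommGroup H] [InnerProductSpace ℂ H] {ι : Type*}

/-- `e` is a Riesz sequence in `H`. -/
def IsRieszSequence (e : ι → H) : Prop :=
  ∃ α β : ℝ, 0 < α ∧ α ≤ β ∧ ∀ (s : Finset ι) (c : ι → ℂ),
    α * ∑ i ∈ s, ‖c i‖ ^ 2 ≤ ‖∑ i ∈ s, c i • e i‖ ^ 2 ∧
      ‖∑ i ∈ s, c i • e i‖ ^ 2 ≤ β * ∑ i ∈ s, ‖c i‖ ^ 2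

/-- `e` is a frame for the subspace `V`. -/
def IsFrameFor (V : Submodule ℂ H) (e : ι → H) : Prop :=
  (∀ i, e i ∈ V) ∧ ∃ α β : ℝ, 0 < α ∧ α ≤ β ∧ ∀ f ∈ V,
    Summable (fun i => ‖inner ℂ (e i) f‖ ^ 2) ∧
      α * ‖f‖ ^ 2 ≤ ∑' i, ‖inner ℂ (e i) f‖ ^ 2 ∧
      ∑' i, ‖inner ℂ (e i) f‖ ^ 2 ≤ β * ‖f‖ ^ 2

end Frames

/-! ### The invariant subspace and the samples -/

section Sampling

variable {G : Type*} [AddCommGroup G] {H : Type*} [NormedAddCommGroup H] [InnerProductSpace ℂ H]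
  {M N : ℕ}

/-- The system `U(g) v_k`, indexed by `k` and `g`. -/
def orbit (U : Multiplicative G →* (H ≃ₗᵢ[ℂ] H)) {K : ℕ} (v : Fin K → H) (p : Fin K × G) : H :=
  U (Multiplicative.ofAdd p.2) (v p.1)

/-- The subspace `V_Φ`, the closed span of the `U(g) φ_n`. -/
def invSubspace (U : Multiplicative G →* (H ≃ₗᵢ[ℂ] H)) (φ : Fin N → H) : Submodule ℂ H :=
  (Submodule.span ℂ (Set.range (orbit U φ))).topologicalClosure

/-- `f = ∑_n ∑_g x_n(g) U(g) φ_n`, with convergence in `H`. In other words, `f = T_{U,Φ} x`. -/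
def IsSynthesis (U : Multiplicative G →* (H ≃ₗᵢ[ℂ] H)) (φ : Fin N → H) (x : EllTwoN G N)
    (f : H) : Prop :=
  HasSum (fun p : Fin N × G => x p.1 p.2 • orbit U φ p) f

/-- The coefficient vector `x ∈ ℓ²_N(G)` of `f = ∑_n ∑_g x_n(g) U(g) φ_n`; when the `U(g) φ_n` form
a Riesz sequence, it exists and is unique for every `f` in `V_Φ`. -/
def coeffs (U : Multiplicative G →* (H ≃ₗᵢ[ℂ] H)) (φ : Fin N → H) (f : H) : EllTwoN G N :=
  Classical.epsilon fun x => IsSynthesis U φ x f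

/-- The samples `L_m f(g) = (A * x)_m(g)`, where `x` is the coefficient vector of `f`. -/
def samples (U : Multiplicative G →* (H ≃ₗᵢ[ℂ] H)) (φ : Fin N → H) (A : EllTwoMatrix G M N)
    (f : H) : Fin M → G → ℂ :=
  matConv A (fun n => coeffs U φ f n)

/-- The elements `S_m` of `V_Φ` generate a frame `U(g) S_m` for `V_Φ`, and every `f` in `V_Φ` is
`∑_m ∑_g L_m f(g) U(g) S_m`. -/
def IsReconstruction (U : Multiplicative G →* (H ≃ₗᵢ[ℂ] H)) (φ : Fin N → H)
    (A : EllTwoMatrix G M N) (S : Fin M → H) : Prop :=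
  (∀ m, S m ∈ invSubspace U φ) ∧ IsFrameFor (invSubspace U φ) (orbit U S) ∧
    ∀ f ∈ invSubspace U φ,
      HasSum (fun p : Fin M × G => samples U φ A f p.1 p.2 • orbit U S p) f

end Sampling

end ConvSampling

end

open ConvSampling

/-!
The Plancherel transform turns `ℓ²(G)` into `L²(Ĝ)` and convolution by `a` into multiplication by
`â` (`hasSum_convolution`), so that `x ↦ A * x` is multiplication by the matrix function `Â`
(`fourierVec_convOp`), while the Riesz sequence hypothesis makes the synthesis map
`x ↦ ∑ x_n(g) U(g) φ_n` an isomorphism `T` of `ℓ²_N(G)` onto `V_Φ` (`exists_synthesisEquiv`).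
Through `T`, the sampling map `f ↦ L f` becomes `x ↦ A * x`.

The seven conditions are linked in the cycle (a) ⇒ (c) ⇒ (d) ⇒ (e) ⇒ (f) ⇒ (b) ⇒ (a).

* Where `det (Âᴴ Â)` is bounded away from zero, Cramer's rule bounds the pseudo-inverse
  `(Âᴴ Â)⁻¹ Âᴴ` (`exists_bounded_left_inverse`). A bounded left inverse of `Â` is the transfer matrix
  of a convolution system `B` which is a left inverse of `A` (`convOp_comp_eq_id_iff`).
* If `B` is a left inverse of `A` and `S_m` is synthesized from the `m`-th column of `B`, then
  `U(g) S_m` is the image under `T ∘ B` of the unit vector of `ℓ²_M(G)` in position `(m, g)`. The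
  identity `T x = T B (A x)` is then the reconstruction formula, and the image of an orthonormal
  basis under an operator with a bounded right inverse is a frame (`isFrameFor_of_rightInverse`).
* A reconstruction formula along a frame bounds `‖f‖` by the norm of the samples, by the
  Cauchy–Schwarz inequality (`norm_sq_le_of_hasSum_smul`).
* If `x ↦ A * x` is bounded below, testing it on vectors `1_E c` shows that `Â(ξ)` is bounded below
  for almost every `ξ` (`transfer_bounded_below`), hence so are the eigenvalues and the determinant
  of `Âᴴ Â`.

For the last assertion, let `B` be the coefficient matrix of the `S_m`. The upper frame bound of
`U(g) S_m`, again tested on functions `1_E`, forces `B̂` to be bounded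
(`transferBounded_of_isFrameFor`); the reconstruction formula then reads `T B A x = T x`, so `B` is
a left inverse of `A`.
-/

noncomputable section

namespace ConvSampling

/-! ### Plancherel's theorem on the dual group -/

section Plancherel

variable {G : Type*} [AddCommGroup G] [TopologicalSpace G]

theorem pairing_add (g h : G) (ξ : DualGroup G) :
    pairing (g + h) ξ = pairing g ξ * pairing h ξ := by
  simp [pairing, ofAdd_add]

theorem pairing_zero (ξ : DualGroup G) : pairing (0 : G) ξ = 1 := by
  simp [pairing]

theorem conj_pairing (g : G) (ξ : DualGroup G) : conj (pairing g ξ) = pairing (-g) ξ := by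
  simp only [pairing, ofAdd_neg, map_inv]
  rw [← Circle.coe_inv_eq_conj]

theorem pairing_sub (g h : G) (ξ : DualGroup G) :
    pairing (g - h) ξ = pairing g ξ * conj (pairing h ξ) := by
  rw [sub_eq_add_neg, pairing_add, conj_pairing]

theorem norm_pairing (g : G) (ξ : DualGroup G) : ‖pairing g ξ‖ = 1 :=
  Circle.norm_coe _

/-- The function `ξ ↦ conj ⟨g, ξ⟩` as a continuous function on the dual group. -/
def charMap (g : G) : C(DualGroup G, ℂ) :=
  ⟨fun ξ => conj (pairing g ξ), Complex.continuous_conj.comp (continuous_pairing g)⟩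

@[simp]
theorem charMap_apply (g : G) (ξ : DualGroup G) : charMap g ξ = conj (pairing g ξ) := rfl

variable (G) in
/-- The star subalgebra of `C(Ĝ, ℂ)` generated by the characters `ξ ↦ conj ⟨g, ξ⟩`. -/
def charSubalgebra : StarSubalgebra ℂ C(DualGroup G, ℂ) where
  toSubalgebra := Algebra.adjoin ℂ (Set.range charMap)
  star_mem' := by
    change Algebra.adjoin ℂ (Set.range (charMap (G := G))) ≤
      star (Algebra.adjoin ℂ (Set.range (charMap (G := G))))
    refine Algebra.adjoin_le ?_
    rintro - ⟨g, rfl⟩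
    refine Algebra.subset_adjoin ⟨-g, ?_⟩
    ext ξ
    simp [← conj_pairing]

variable (G) in
theorem toSubmodule_charSubalgebra :
    Subalgebra.toSubmodule (charSubalgebra G).toSubalgebra
      = Submodule.span ℂ (Set.range (charMap (G := G))) := by
  apply Algebra.adjoin_eq_span_of_subset
  refine Set.Subset.trans ?_ Submodule.subset_span
  intro x hx
  refine Submonoid.closure_induction (fun _ => id) ⟨0, ?_⟩ ?_ hx
  · ext ξ
    simp [pairing_zero]
  · rintro - - - - ⟨m, rfl⟩ ⟨n, rfl⟩
    refine ⟨m + n, ?_⟩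
    ext ξ
    simp [pairing_add]

variable (G) in
theorem separatesPoints_charSubalgebra : (charSubalgebra G).SeparatesPoints := by
  intro x y hxy
  obtain ⟨g, hg⟩ : ∃ g : Multiplicative G, x g ≠ y g := by
    by_contra! h
    exact hxy (DFunLike.ext x y h)
  refine ⟨_, ⟨charMap g.toAdd, Algebra.subset_adjoin ⟨g.toAdd, rfl⟩, rfl⟩, fun h => hg ?_⟩
  exact Circle.coe_injective ((starRingEnd ℂ).injective h)

variable [DiscreteTopology G]

variable (G) in
/-- Trigonometric polynomials are dense in `C(Ĝ)` by the Stone–Weierstrass theorem, hence in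
`L²(Ĝ)`. -/
theorem span_charLp_closure_eq_top :
    (Submodule.span ℂ (Set.range (charLp (G := G)))).topologicalClosure = ⊤ := by
  have h1 : (Submodule.span ℂ (Set.range (charMap (G := G)))).topologicalClosure = ⊤ := by
    rw [← toSubmodule_charSubalgebra]
    exact congr_arg (Subalgebra.toSubmodule <| StarSubalgebra.toSubalgebra ·)
      (ContinuousMap.starSubalgebra_topologicalClosure_eq_top_of_separatesPoints
        (charSubalgebra G) (separatesPoints_charSubalgebra G))
  have : (dualHaar G).Regular := by unfold dualHaar; infer_instance
  have h2 := (ContinuousMap.toLp_denseRange ℂ (dualHaar G) ℂ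
    (p := 2) (by simp)).topologicalClosure_map_submodule h1
  rw [Submodule.map_span, ← Set.range_comp] at h2
  exact h2

variable (G) in
/-- The Plancherel transform as an isometric isomorphism `ℓ²(G) ≃ L²(Ĝ)`. -/
def fourierEquiv : EllTwo G ≃ₗᵢ[ℂ] Lp ℂ 2 (dualHaar G) :=
  LinearIsometryEquiv.ofSurjective (fourierL2 G) <| by
    have h := (orthonormal_charLp G).orthogonalFamily.range_linearIsometry
    rw [← LinearIsometry.coe_toLinearMap, ← LinearMap.range_eq_top]
    refine h.trans ?_
    rw [eq_top_iff, ← span_charLp_closure_eq_top G]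
    refine Submodule.topologicalClosure_mono (Submodule.span_le.2 ?_)
    rintro - ⟨g, rfl⟩
    refine Submodule.mem_iSup_of_mem g ⟨1, ?_⟩
    simp

@[simp]
theorem fourierEquiv_apply (x : EllTwo G) : fourierEquiv G x = fourierL2 G x := rfl

@[simp]
theorem fourierL2_symm_apply (f : Lp ℂ 2 (dualHaar G)) :
    fourierL2 G ((fourierEquiv G).symm f) = f :=
  (fourierEquiv G).apply_symm_apply f

theorem fourierL2_single [DecidableEq G] (g : G) (c : ℂ) :
    fourierL2 G (lp.single 2 g c) = c • charLp g := by
  have h := (orthonormal_charLp G).orthogonalFamily.linearIsometry_apply_single (i := g) c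
  refine h.trans ?_
  simp

theorem coeFn_charLp (g : G) : charLp g =ᵐ[dualHaar G] fun ξ => conj (pairing g ξ) :=
  ContinuousMap.coeFn_toLp (dualHaar G) (charMap g)

theorem inner_charLp_fourierL2 (g : G) (x : EllTwo G) :
    inner ℂ (charLp g) (fourierL2 G x) = x g := by
  classical
  have h : charLp g = fourierL2 G (lp.single 2 g 1) := by simp [fourierL2_single]
  rw [h, LinearIsometry.inner_map_map, lp.inner_single_left]
  simp

/-- `x(g)` is the integral of `⟨g, ·⟩ x̂`. -/
theorem integral_pairing_mul_fourierL2 (g : G) (x : EllTwo G) :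
    ∫ ξ, pairing g ξ * fourierL2 G x ξ ∂(dualHaar G) = x g := by
  rw [← inner_charLp_fourierL2, L2.inner_def]
  refine integral_congr_ae ?_
  filter_upwards [coeFn_charLp g] with ξ hξ
  simp [hξ, mul_comm]

theorem fourierEquiv_symm_apply (f : Lp ℂ 2 (dualHaar G)) (g : G) :
    (fourierEquiv G).symm f g = ∫ ξ, pairing g ξ * f ξ ∂(dualHaar G) := by
  rw [← integral_pairing_mul_fourierL2, fourierL2_symm_apply]

theorem aestronglyMeasurable_pairing (g : G) :
    AEStronglyMeasurable (pairing g) (dualHaar G) :=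
  (continuous_pairing g).aestronglyMeasurable

theorem memLp_top_pairing (g : G) : MemLp (pairing g) ∞ (dualHaar G) :=
  memLp_top_of_bound (aestronglyMeasurable_pairing g) 1 (by simp [norm_pairing])

theorem memLp_fourierL2 (x : EllTwo G) : MemLp (fourierL2 G x) 2 (dualHaar G) :=
  Lp.memLp _

/-- The convolution theorem for `ℓ²` sequences: `(a * x)(g)` is the integral of
`⟨g, ·⟩ â x̂`. It is Parseval's identity for `x` and `g' ↦ conj (a (g - g'))`. -/
theorem hasSum_convolution (a x : EllTwo G) (g : G) :
    HasSum (fun g' => a (g - g') * x g')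
      (∫ ξ, pairing g ξ * (fourierL2 G a ξ * fourierL2 G x ξ) ∂(dualHaar G)) := by
  have hm : MemLp (fun ξ => conj (pairing g ξ * fourierL2 G a ξ)) 2 (dualHaar G) :=
    ((memLp_fourierL2 a).mul' (memLp_top_pairing g)).star
  set h := hm.toLp _ with hh
  -- The inverse transform of `conj (⟨g, ·⟩ â)` is `g' ↦ conj (a (g - g'))`.
  have hb : ∀ g', (fourierEquiv G).symm h g' = conj (a (g - g')) := fun g' => by
    rw [fourierEquiv_symm_apply, ← integral_pairing_mul_fourierL2, ← integral_conj]
    refine integral_congr_ae ?_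
    filter_upwards [hm.coeFn_toLp] with ξ hξ
    rw [← hh] at hξ
    rw [hξ, pairing_sub]
    simp
    ring
  have hs := lp.hasSum_inner (𝕜 := ℂ) ((fourierEquiv G).symm h) x
  rw [← (fourierEquiv G).inner_map_map, LinearIsometryEquiv.apply_symm_apply, L2.inner_def] at hs
  have h1 : ∀ g', a (g - g') * x g' = inner ℂ ((fourierEquiv G).symm h g') (x g') := fun g' => by
    rw [hb, RCLike.inner_apply, Complex.conj_conj, mul_comm]
  have h2 : ∫ ξ, pairing g ξ * (fourierL2 G a ξ * fourierL2 G x ξ) ∂(dualHaar G)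
      = ∫ ξ, inner ℂ (h ξ) (fourierL2 G x ξ) ∂(dualHaar G) := by
    refine integral_congr_ae ?_
    filter_upwards [hm.coeFn_toLp] with ξ hξ
    rw [← hh] at hξ
    rw [hξ, RCLike.inner_apply, Complex.conj_conj]
    ring
  simp only [h1, h2]
  exact hs

end Plancherel

/-! ### Convolution systems as multipliers -/

section ConvOp

variable {G : Type*} [AddCommGroup G] [TopologicalSpace G] [DiscreteTopology G] {M N : ℕ}

/-- Convolution by `a ∈ ℓ²(G)` with `â` bounded, as an operator on `ℓ²(G)`: it is the multiplication
by `â`, conjugated by the Plancherel transform. -/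
def convEntry (a : EllTwo G) (ha : MemLp (fourierL2 G a) ∞ (dualHaar G)) :
    EllTwo G →L[ℂ] EllTwo G :=
  (fourierEquiv G).symm.toContinuousLinearEquiv.toContinuousLinearMap ∘L
    (ContinuousLinearMap.mul ℂ ℂ).holderL (dualHaar G) ∞ 2 2 (ha.toLp _) ∘L
    (fourierL2 G).toContinuousLinearMap

theorem fourierL2_convEntry (a : EllTwo G) (ha : MemLp (fourierL2 G a) ∞ (dualHaar G))
    (x : EllTwo G) :
    fourierL2 G (convEntry a ha x) =ᵐ[dualHaar G] fun ξ => fourierL2 G a ξ * fourierL2 G x ξ := by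
  have h : fourierL2 G (convEntry a ha x)
      = (ContinuousLinearMap.mul ℂ ℂ).holder 2 (ha.toLp _) (fourierL2 G x) := by
    rw [← ContinuousLinearMap.holderL_apply_apply]
    exact fourierL2_symm_apply _
  rw [h]
  filter_upwards [(ContinuousLinearMap.mul ℂ ℂ).coeFn_holder (r := 2) (ha.toLp _) (fourierL2 G x),
    ha.coeFn_toLp] with ξ h1 h2
  rw [h1, h2]
  rfl

theorem convEntry_apply (a : EllTwo G) (ha : MemLp (fourierL2 G a) ∞ (dualHaar G))
    (x : EllTwo G) (g : G) : convEntry a ha x g = ∑' g', a (g - g') * x g' := by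
  rw [(hasSum_convolution a x g).tsum_eq, ← integral_pairing_mul_fourierL2]
  refine integral_congr_ae ?_
  filter_upwards [fourierL2_convEntry a ha x] with ξ hξ
  rw [hξ]

/-- The bounded convolution system `x ↦ A * x` of a matrix `A` with bounded transfer matrix. -/
def convOp (A : EllTwoMatrix G M N) (hA : TransferBounded A) : EllTwoN G N →L[ℂ] EllTwoN G M :=
  (PiLp.continuousLinearEquiv 2 ℂ (fun _ : Fin M => EllTwo G)).symm.toContinuousLinearMap ∘L
    ContinuousLinearMap.pi fun m => ∑ n, convEntry (A m n) (hA m n) ∘L PiLp.proj 2 _ n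

theorem convOp_apply (A : EllTwoMatrix G M N) (hA : TransferBounded A) (x : EllTwoN G N)
    (m : Fin M) : convOp A hA x m = ∑ n, convEntry (A m n) (hA m n) (x n) := by
  simp [convOp]

theorem isConvolutionBy_convOp (A : EllTwoMatrix G M N) (hA : TransferBounded A) :
    IsConvolutionBy (convOp A hA) A := by
  intro x m g
  rw [convOp_apply, matConv, lp.coeFn_sum, Finset.sum_apply]
  simp only [convEntry_apply]

/-- A continuous linear map which is the convolution by `A` is `convOp A`. -/
theorem IsConvolutionBy.eq_convOp {T : EllTwoN G N →L[ℂ] EllTwoN G M} {A : EllTwoMatrix G M N}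
    (hT : IsConvolutionBy T A) (hA : TransferBounded A) : T = convOp A hA := by
  ext x m g
  rw [hT, isConvolutionBy_convOp]

/-- The vector `x̂(ξ)` of the Fourier transforms of the components of `x`. -/
def fourierVec (x : EllTwoN G N) (ξ : DualGroup G) : Fin N → ℂ := fun n => fourierL2 G (x n) ξ

/-- In the Fourier domain, `A` acts by multiplication by its transfer matrix. -/
theorem fourierVec_convOp (A : EllTwoMatrix G M N) (hA : TransferBounded A) (x : EllTwoN G N) :
    ∀ᵐ ξ ∂(dualHaar G), fourierVec (convOp A hA x) ξ = transfer A ξ *ᵥ fourierVec x ξ := by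
  have h1 : ∀ᵐ ξ ∂(dualHaar G), ∀ m n, fourierL2 G (convEntry (A m n) (hA m n) (x n)) ξ
      = fourierL2 G (A m n) ξ * fourierL2 G (x n) ξ :=
    ae_all_iff.2 fun m => ae_all_iff.2 fun n => fourierL2_convEntry _ _ _
  have h2 : ∀ᵐ ξ ∂(dualHaar G), ∀ m, fourierL2 G (convOp A hA x m) ξ
      = ∑ n, fourierL2 G (convEntry (A m n) (hA m n) (x n)) ξ := by
    refine ae_all_iff.2 fun m => ?_
    rw [convOp_apply, map_sum]
    filter_upwards [Lp.coeFn_finsetSum Finset.univ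
      fun n => fourierL2 G (convEntry (A m n) (hA m n) (x n))] with ξ hξ
    rw [hξ, Finset.sum_apply]
  filter_upwards [h1, h2] with ξ h1 h2
  funext m
  simp [fourierVec, h2, h1, transfer, Matrix.mulVec, dotProduct]

theorem fourierVec_injective {x y : EllTwoN G N}
    (h : ∀ᵐ ξ ∂(dualHaar G), fourierVec x ξ = fourierVec y ξ) : x = y := by
  refine PiLp.ext fun n => (fourierL2 G).injective (Lp.ext ?_)
  filter_upwards [h] with ξ hξ
  exact congrFun hξ n

/-- The element of `ℓ²_N(G)` with prescribed Fourier transforms. -/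
def ofFourier (f : Fin N → DualGroup G → ℂ) (hf : ∀ n, MemLp (f n) 2 (dualHaar G)) : EllTwoN G N :=
  WithLp.toLp 2 fun n => (fourierEquiv G).symm ((hf n).toLp _)

theorem fourierVec_ofFourier (f : Fin N → DualGroup G → ℂ)
    (hf : ∀ n, MemLp (f n) 2 (dualHaar G)) :
    ∀ᵐ ξ ∂(dualHaar G), ∀ n, fourierVec (ofFourier f hf) ξ n = f n ξ := by
  refine ae_all_iff.2 fun n => ?_
  have h : ofFourier f hf n = (fourierEquiv G).symm ((hf n).toLp _) := rfl
  simp only [fourierVec, h, fourierL2_symm_apply]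
  exact (hf n).coeFn_toLp

/-- Left inverses of a convolution system correspond to pointwise left inverses of the transfer
matrix. -/
theorem convOp_comp_eq_id_iff (A : EllTwoMatrix G M N) (hA : TransferBounded A)
    (B : EllTwoMatrix G N M) (hB : TransferBounded B) :
    convOp B hB ∘L convOp A hA = ContinuousLinearMap.id ℂ _ ↔
      ∀ᵐ ξ ∂(dualHaar G), transfer B ξ * transfer A ξ = 1 := by
  have key : ∀ x, ∀ᵐ ξ ∂(dualHaar G), fourierVec (convOp B hB (convOp A hA x)) ξ
      = (transfer B ξ * transfer A ξ) *ᵥ fourierVec x ξ := fun x => by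
    filter_upwards [fourierVec_convOp A hA x, fourierVec_convOp B hB (convOp A hA x)] with ξ h1 h2
    rw [h2, h1, Matrix.mulVec_mulVec]
  constructor
  · intro h
    -- Apply the identity to the vectors whose transforms are the constant vectors `e_k`; this reads
    -- off the columns of `B̂ Â`.
    have hf : ∀ (k n : Fin N), MemLp (fun _ : DualGroup G => (Pi.single k 1 : Fin N → ℂ) n) 2
      (dualHaar G) := fun k n => memLp_const _
    have h1 : ∀ᵐ ξ ∂(dualHaar G), ∀ k n,
        fourierVec (ofFourier _ (hf k)) ξ n = (Pi.single k 1 : Fin N → ℂ) n :=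
      ae_all_iff.2 fun k => fourierVec_ofFourier _ (hf k)
    have h2 : ∀ᵐ ξ ∂(dualHaar G), ∀ k, fourierVec (ofFourier _ (hf k)) ξ
        = (transfer B ξ * transfer A ξ) *ᵥ fourierVec (ofFourier _ (hf k)) ξ := by
      refine ae_all_iff.2 fun k => ?_
      have h3 := key (ofFourier _ (hf k))
      have h4 : convOp B hB (convOp A hA (ofFourier _ (hf k))) = ofFourier _ (hf k) :=
        DFunLike.congr_fun h _
      rwa [h4] at h3
    filter_upwards [h1, h2] with ξ h1 h2
    ext i k
    have h3 : fourierVec (ofFourier _ (hf k)) ξ = Pi.single k 1 := funext (h1 k)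
    have h4 := congrFun (h2 k) i
    rw [h3, Matrix.mulVec_single_one] at h4
    rw [Matrix.one_apply, ← Pi.single_apply, h4]
    rfl
  · intro h
    ext1 x
    refine fourierVec_injective ?_
    filter_upwards [h, key x] with ξ h1 h2
    simp only [ContinuousLinearMap.comp_apply, ContinuousLinearMap.id_apply, h2, h1,
      Matrix.one_mulVec]

/-- Every matrix with bounded measurable entries is a transfer matrix. -/
theorem exists_transfer_eq (F : DualGroup G → Matrix (Fin M) (Fin N) ℂ)
    (hF : ∀ m n, MemLp (fun ξ => F ξ m n) ∞ (dualHaar G)) :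
    ∃ B : EllTwoMatrix G M N, TransferBounded B ∧
      ∀ᵐ ξ ∂(dualHaar G), transfer B ξ = F ξ := by
  have hF2 : ∀ m n, MemLp (fun ξ => F ξ m n) 2 (dualHaar G) := fun m n =>
    (hF m n).mono_exponent le_top
  have h : ∀ m n, fourierL2 G ((fourierEquiv G).symm ((hF2 m n).toLp _))
      =ᵐ[dualHaar G] fun ξ => F ξ m n := fun m n => by
    rw [fourierL2_symm_apply]
    exact (hF2 m n).coeFn_toLp
  refine ⟨Matrix.of fun m n => (fourierEquiv G).symm ((hF2 m n).toLp _),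
    fun m n => (memLp_congr_ae (h m n)).2 (hF m n), ?_⟩
  have h' := ae_all_iff.2 fun m => ae_all_iff.2 fun n => h m n
  filter_upwards [h'] with ξ hξ
  ext m n
  exact hξ m n

theorem norm_fourierL2_sq (x : EllTwo G) :
    ‖x‖ ^ 2 = ∫ ξ, ‖fourierL2 G x ξ‖ ^ 2 ∂(dualHaar G) := by
  rw [← (fourierL2 G).norm_map x, ← Complex.ofReal_inj, ← integral_complex_ofReal]
  rw [Complex.ofReal_pow]
  refine (inner_self_eq_norm_sq_to_K (𝕜 := ℂ) (fourierL2 G x)).symm.trans ?_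
  rw [L2.inner_def]
  simp [inner_self_eq_norm_sq_to_K]

theorem integrable_norm_fourierL2_sq (x : EllTwo G) :
    Integrable (fun ξ => ‖fourierL2 G x ξ‖ ^ 2) (dualHaar G) :=
  (memLp_fourierL2 x).integrable_norm_pow (by simp)

theorem integrable_norm_fourierVec_sq (x : EllTwoN G N) :
    Integrable (fun ξ => ∑ n, ‖fourierVec x ξ n‖ ^ 2) (dualHaar G) :=
  integrable_finsetSum _ fun n _ => integrable_norm_fourierL2_sq (x n)

/-- Plancherel's identity in `ℓ²_N(G)`. -/
theorem norm_sq_eq_integral_fourierVec (x : EllTwoN G N) :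
    ‖x‖ ^ 2 = ∫ ξ, ∑ n, ‖fourierVec x ξ n‖ ^ 2 ∂(dualHaar G) := by
  unfold fourierVec
  rw [PiLp.norm_sq_eq_of_L2, integral_finsetSum _ fun n _ => integrable_norm_fourierL2_sq (x n)]
  exact Finset.sum_congr rfl fun n _ => norm_fourierL2_sq (x n)

end ConvOp

/-! ### Bounded left inverses of the transfer matrix -/

section LinearAlgebra

variable {M N : ℕ}

/-- A matrix bounded below by `α`, in the sense that `α ‖c‖² ≤ ‖Q c‖²`, satisfies
`α ^ N ≤ det (Qᴴ Q)`, as the eigenvalues of `Qᴴ Q` are at least `α`. -/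
theorem pow_le_det_conjTranspose_mul_self (Q : Matrix (Fin M) (Fin N) ℂ) {α : ℝ} (hα : 0 ≤ α)
    (h : ∀ c : Fin N → ℂ, α * ∑ n, ‖c n‖ ^ 2 ≤ ∑ m, ‖(Q *ᵥ c) m‖ ^ 2) :
    α ^ N ≤ (Qᴴ * Q).det.re := by
  have hH : (Qᴴ * Q).IsHermitian := Matrix.isHermitian_conjTranspose_mul_self Q
  have hev : ∀ i, α ≤ hH.eigenvalues i := fun i => by
    have h1 := h (hH.eigenvectorBasis i)
    have h2 : ∑ n, ‖hH.eigenvectorBasis i n‖ ^ 2 = 1 := by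
      rw [← EuclideanSpace.norm_sq_eq, hH.eigenvectorBasis.orthonormal.1 i, one_pow]
    rw [h2, mul_one] at h1
    refine h1.trans_eq ?_
    rw [hH.eigenvalues_eq, ← Matrix.mulVec_mulVec, Matrix.dotProduct_mulVec,
      Matrix.vecMul_conjTranspose, star_star, dotProduct, map_sum]
    refine Finset.sum_congr rfl fun m _ => ?_
    rw [Pi.star_apply, RCLike.star_def, RCLike.conj_mul]
    norm_cast
  rw [hH.det_eq_prod_eigenvalues]
  have : (∏ i, (hH.eigenvalues i : ℂ)).re = ∏ i, hH.eigenvalues i := by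
    rw [← Complex.ofReal_prod, Complex.ofReal_re]
  refine le_trans ?_ this.symm.le
  calc α ^ N = ∏ _i : Fin N, α := by simp
    _ ≤ _ := Finset.prod_le_prod (fun _ _ => hα) fun i _ => hev i

open scoped ComplexOrder in
theorem det_conjTranspose_mul_self_re_nonneg (Q : Matrix (Fin M) (Fin N) ℂ) :
    0 ≤ (Qᴴ * Q).det.re :=
  (Complex.le_def.1 (Matrix.posSemidef_conjTranspose_mul_self Q).det_nonneg).1

end LinearAlgebra

section MemLpTop

variable {X : Type*} [MeasurableSpace X] {μ : Measure X}

theorem memLp_top_finsetProd {ι : Type*} (s : Finset ι) {f : ι → X → ℂ}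
    (hf : ∀ i ∈ s, MemLp (f i) ∞ μ) : MemLp (fun x => ∏ i ∈ s, f i x) ∞ μ := by
  classical
  induction s using Finset.induction_on with
  | empty => simpa using memLp_top_const (1 : ℂ)
  | insert i s hi ih =>
    simp only [Finset.prod_insert hi]
    exact (ih fun j hj => hf j (Finset.mem_insert_of_mem hj)).mul'
      (hf i (Finset.mem_insert_self _ _))

theorem memLp_top_det {N : ℕ} {P : X → Matrix (Fin N) (Fin N) ℂ}
    (hP : ∀ i j, MemLp (fun x => P x i j) ∞ μ) : MemLp (fun x => (P x).det) ∞ μ := by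
  simp only [Matrix.det_apply]
  refine memLp_finsetSum _ fun σ _ => ?_
  simp only [Units.smul_def, zsmul_eq_mul]
  exact (memLp_top_finsetProd _ fun i _ => hP (σ i) i).const_mul _

theorem memLp_top_matrix_mul {M N K : ℕ} {P : X → Matrix (Fin M) (Fin N) ℂ}
    {Q : X → Matrix (Fin N) (Fin K) ℂ} (hP : ∀ i j, MemLp (fun x => P x i j) ∞ μ)
    (hQ : ∀ i j, MemLp (fun x => Q x i j) ∞ μ) (i : Fin M) (k : Fin K) :
    MemLp (fun x => (P x * Q x) i k) ∞ μ := by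
  simp only [Matrix.mul_apply]
  exact memLp_finsetSum _ fun j _ => (hQ j k).mul' (hP i j)

theorem memLp_top_conjTranspose {M N : ℕ} {P : X → Matrix (Fin M) (Fin N) ℂ}
    (hP : ∀ i j, MemLp (fun x => P x i j) ∞ μ) (i : Fin N) (j : Fin M) :
    MemLp (fun x => (P x)ᴴ i j) ∞ μ :=
  (hP j i).star

theorem memLp_top_adjugate {N : ℕ} {P : X → Matrix (Fin N) (Fin N) ℂ}
    (hP : ∀ i j, MemLp (fun x => P x i j) ∞ μ) (i j : Fin N) :
    MemLp (fun x => (P x).adjugate i j) ∞ μ := by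
  simp only [Matrix.adjugate_apply]
  refine memLp_top_det fun k l => ?_
  simp only [Matrix.updateRow_apply]
  split_ifs
  · exact memLp_top_const _
  · exact hP k l

/-- If `Q` is bounded and `det (Qᴴ Q)` is bounded away from zero, then the pseudo-inverse
`(Qᴴ Q)⁻¹ Qᴴ`, computed by Cramer's rule, is bounded. -/
theorem exists_bounded_left_inverse {M N : ℕ} {Q : X → Matrix (Fin M) (Fin N) ℂ}
    (hQ : ∀ i j, MemLp (fun x => Q x i j) ∞ μ) {δ : ℝ} (hδ : 0 < δ)
    (h : ∀ᵐ x ∂μ, δ ≤ ((Q x)ᴴ * Q x).det.re) :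
    ∃ F : X → Matrix (Fin N) (Fin M) ℂ, (∀ i j, MemLp (fun x => F x i j) ∞ μ) ∧
      ∀ᵐ x ∂μ, F x * Q x = 1 := by
  have hQs := memLp_top_conjTranspose hQ
  have hP := memLp_top_matrix_mul hQs hQ
  have hdet := memLp_top_det hP
  have hinv : MemLp (fun x => (((Q x)ᴴ * Q x).det)⁻¹) ∞ μ := by
    refine memLp_top_of_bound hdet.1.aemeasurable.inv.aestronglyMeasurable δ⁻¹ ?_
    filter_upwards [h] with x hx
    rw [norm_inv]
    exact inv_anti₀ hδ (hx.trans (Complex.re_le_norm _))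
  refine ⟨fun x => (((Q x)ᴴ * Q x).det)⁻¹ • (((Q x)ᴴ * Q x).adjugate * (Q x)ᴴ),
    fun i j => ?_, ?_⟩
  · simp only [Matrix.smul_apply, smul_eq_mul]
    exact (memLp_top_matrix_mul (memLp_top_adjugate hP) hQs i j).mul' hinv
  · filter_upwards [h] with x hx
    have hne : ((Q x)ᴴ * Q x).det ≠ 0 := fun h0 => by
      rw [h0, Complex.zero_re] at hx
      exact absurd hx (not_le.2 hδ)
    rw [Matrix.smul_mul, Matrix.mul_assoc, Matrix.adjugate_mul, smul_smul, inv_mul_cancel₀ hne,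
      one_smul]

/-- A nonnegative bounded function has positive essential infimum if and only if it is bounded
below almost everywhere by a positive constant. -/
theorem essInf_pos_iff [NeZero μ] {f : X → ℝ} (hf0 : ∀ x, 0 ≤ f x) {C : ℝ}
    (hfC : ∀ᵐ x ∂μ, f x ≤ C) : 0 < essInf f μ ↔ ∃ δ > 0, ∀ᵐ x ∂μ, δ ≤ f x := by
  constructor
  · exact fun h => ⟨_, h, ae_essInf_le (hf := Filter.isBoundedUnder_of ⟨0, hf0⟩)⟩
  · rintro ⟨δ, hδ, h⟩
    refine hδ.trans_le (le_essInf_of_ae_le δ h ?_)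
    exact Filter.IsBoundedUnder.isCoboundedUnder_ge ⟨C, hfC⟩

end MemLpTop

section Transfer

variable {G : Type*} [AddCommGroup G] [TopologicalSpace G] [DiscreteTopology G] {M N : ℕ}

theorem essInf_det_transfer_pos_iff (A : EllTwoMatrix G M N) (hA : TransferBounded A) :
    0 < essInf (fun ξ => ((transfer A ξ)ᴴ * transfer A ξ).det.re) (dualHaar G) ↔
      ∃ δ > 0, ∀ᵐ ξ ∂(dualHaar G), δ ≤ ((transfer A ξ)ᴴ * transfer A ξ).det.re := by
  have hdet : MemLp (fun ξ => ((transfer A ξ)ᴴ * transfer A ξ).det) ∞ (dualHaar G) :=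
    memLp_top_det (memLp_top_matrix_mul (memLp_top_conjTranspose hA) hA)
  refine essInf_pos_iff (fun ξ => det_conjTranspose_mul_self_re_nonneg _)
    (C := (eLpNorm (fun ξ => ((transfer A ξ)ᴴ * transfer A ξ).det) ∞ (dualHaar G)).toReal) ?_
  filter_upwards [ae_le_eLpNormEssSup (μ := dualHaar G)
    (f := fun ξ => ((transfer A ξ)ᴴ * transfer A ξ).det)] with ξ hξ
  refine (Complex.re_le_norm _).trans ?_
  rw [← eLpNorm_exponent_top] at hξ
  have := (ENNReal.toReal_le_toReal (by simp) hdet.2.ne).2 hξ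
  simpa using this

/-- If `x ↦ A * x` is bounded below, so are the matrices `Â(ξ)` for almost every `ξ`: test the
operator on the functions equal to a constant vector `c` on a measurable set and to `0` outside,
then let `c` run through a countable dense set. -/
theorem transfer_bounded_below (A : EllTwoMatrix G M N) (hA : TransferBounded A) {α : ℝ}
    (h : ∀ x, α * ‖x‖ ^ 2 ≤ ‖convOp A hA x‖ ^ 2) :
    ∀ᵐ ξ ∂(dualHaar G), ∀ c : Fin N → ℂ,
      α * ∑ n, ‖c n‖ ^ 2 ≤ ∑ m, ‖(transfer A ξ *ᵥ c) m‖ ^ 2 := by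
  have hc : ∀ c : Fin N → ℂ, ∀ᵐ ξ ∂(dualHaar G),
      α * ∑ n, ‖c n‖ ^ 2 ≤ ∑ m, ‖(transfer A ξ *ᵥ c) m‖ ^ 2 := by
    intro c
    have hmem : ∀ E : Set (DualGroup G), MeasurableSet E →
        ∀ n, MemLp (E.indicator fun _ => c n) 2 (dualHaar G) := fun E hE n =>
      (memLp_const (c n)).indicator hE
    have hx : ∀ (E : Set (DualGroup G)) (hE : MeasurableSet E), ∀ᵐ ξ ∂(dualHaar G),
        (∑ n, ‖fourierVec (ofFourier _ (hmem E hE)) ξ n‖ ^ 2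
          = E.indicator (fun _ => ∑ n, ‖c n‖ ^ 2) ξ) ∧
        (∑ m, ‖fourierVec (convOp A hA (ofFourier _ (hmem E hE))) ξ m‖ ^ 2
          = E.indicator (fun ξ => ∑ m, ‖(transfer A ξ *ᵥ c) m‖ ^ 2) ξ) := fun E hE => by
      filter_upwards [fourierVec_ofFourier _ (hmem E hE),
        fourierVec_convOp A hA (ofFourier _ (hmem E hE))] with ξ h1 h2
      rw [h2]
      by_cases hξ : ξ ∈ E
      · have h3 : fourierVec (ofFourier _ (hmem E hE)) ξ = c := by
          funext n
          rw [h1, Set.indicator_of_mem hξ]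
        simp [h3, hξ]
      · have h3 : fourierVec (ofFourier _ (hmem E hE)) ξ = 0 := by
          funext n
          rw [h1, Set.indicator_of_notMem hξ, Pi.zero_apply]
        simp [h3, hξ]
    have hint : Integrable (fun ξ => ∑ m, ‖(transfer A ξ *ᵥ c) m‖ ^ 2) (dualHaar G) := by
      refine (integrable_norm_fourierVec_sq
        (convOp A hA (ofFourier _ (hmem Set.univ MeasurableSet.univ)))).congr ?_
      filter_upwards [hx Set.univ MeasurableSet.univ] with ξ hξ
      rw [hξ.2, Set.indicator_univ]
    have hpos := ae_nonneg_of_forall_setIntegral_nonneg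
      (hint.sub (integrable_const (α * ∑ n, ‖c n‖ ^ 2))) fun E hE _ => by
        have h1 := h (ofFourier _ (hmem E hE))
        rw [norm_sq_eq_integral_fourierVec, norm_sq_eq_integral_fourierVec,
          integral_congr_ae ((hx E hE).mono fun ξ h => h.1),
          integral_congr_ae ((hx E hE).mono fun ξ h => h.2),
          integral_indicator hE, integral_indicator hE, ← integral_const_mul] at h1
        have h2 := integral_sub hint.integrableOn
          ((integrable_const (μ := dualHaar G) (α * ∑ n, ‖c n‖ ^ 2)).integrableOn (s := E))
        simp only [Pi.sub_apply]
        rw [h2]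
        exact sub_nonneg.2 h1
    filter_upwards [hpos] with ξ hξ
    exact sub_nonneg.1 hξ
  have hd : ∀ᵐ ξ ∂(dualHaar G), ∀ k,
      α * ∑ n, ‖TopologicalSpace.denseSeq (Fin N → ℂ) k n‖ ^ 2
        ≤ ∑ m, ‖(transfer A ξ *ᵥ TopologicalSpace.denseSeq (Fin N → ℂ) k) m‖ ^ 2 :=
    ae_all_iff.2 fun k => hc _
  filter_upwards [hd] with ξ hξ c
  have hcl : IsClosed {c : Fin N → ℂ |
      α * ∑ n, ‖c n‖ ^ 2 ≤ ∑ m, ‖(transfer A ξ *ᵥ c) m‖ ^ 2} := by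
    have hcont : Continuous fun c : Fin N → ℂ => transfer A ξ *ᵥ c :=
      continuous_const.matrix_mulVec continuous_id
    exact isClosed_le (by fun_prop) (by fun_prop)
  exact hcl.closure_subset_iff.2 (Set.range_subset_iff.2 hξ)
    (TopologicalSpace.denseRange_denseSeq (Fin N → ℂ) c)

end Transfer

/-! ### Synthesis operators of Riesz sequences, and frames -/

section Synthesis

variable {H : Type*} [NormedAddCommGroup H] [InnerProductSpace ℂ H] {ι : Type*}
  {E : Type*} [NormedAddCommGroup E] [InnerProductSpace ℂ E]

theorem hasSum_norm_inner_sq (b : HilbertBasis ι ℂ E) (x : E) :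
    HasSum (fun i => ‖inner ℂ (b i) x‖ ^ 2) (‖x‖ ^ 2) := by
  rw [← Complex.hasSum_ofReal]
  have h := b.hasSum_inner_mul_inner x x
  rw [inner_self_eq_norm_sq_to_K] at h
  have h1 : ∀ i, inner ℂ x (b i) * inner ℂ (b i) x = ((‖inner ℂ (b i) x‖ ^ 2 : ℝ) : ℂ) := fun i => by
    rw [← inner_conj_symm x (b i), RCLike.conj_mul]
    norm_cast
  simp only [h1] at h
  rw [Complex.ofReal_pow]
  exact h

theorem norm_inner_self_eq (f : H) : ‖inner ℂ f f‖ = ‖f‖ ^ 2 := by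
  simp [inner_self_eq_norm_sq_to_K]

/-- The synthesis operator of a Riesz sequence `e`, with coefficients taken along a Hilbert
basis. -/
theorem IsRieszSequence.exists_synthesis [CompleteSpace H] {e : ι → H} (he : IsRieszSequence e)
    (b : HilbertBasis ι ℂ E) :
    ∃ T : E →L[ℂ] H, (∀ x, HasSum (fun i => inner ℂ (b i) x • e i) (T x)) ∧
      ∃ α > 0, ∀ x, α * ‖x‖ ^ 2 ≤ ‖T x‖ ^ 2 := by
  obtain ⟨α, β, hα, hαβ, h⟩ := he
  have hβ : 0 < β := hα.trans_le hαβ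
  have hsum : ∀ x, Summable fun i => inner ℂ (b i) x • e i := fun x => by
    rw [summable_iff_vanishing_norm]
    intro ε hε
    obtain ⟨s, hs⟩ := summable_iff_vanishing_norm.1 (hasSum_norm_inner_sq b x).summable
      (ε ^ 2 / β) (by positivity)
    refine ⟨s, fun t ht => ?_⟩
    have h1 := hs t ht
    rw [Real.norm_of_nonneg (Finset.sum_nonneg fun _ _ => by positivity), lt_div_iff₀ hβ] at h1
    have h2 := (h t fun i => inner ℂ (b i) x).2
    exact lt_of_pow_lt_pow_left₀ 2 hε.le (by linarith)
  have htend : ∀ x, Filter.Tendsto (fun s : Finset ι => ‖∑ i ∈ s, inner ℂ (b i) x • e i‖ ^ 2)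
      Filter.atTop (nhds (‖∑' i, inner ℂ (b i) x • e i‖ ^ 2)) := fun x =>
    ((hsum x).hasSum.norm).pow 2
  have hup : ∀ x, ‖∑' i, inner ℂ (b i) x • e i‖ ^ 2 ≤ β * ‖x‖ ^ 2 := fun x =>
    le_of_tendsto_of_tendsto' (htend x) ((hasSum_norm_inner_sq b x).const_mul β) fun s => (h s _).2
  have hlow : ∀ x, α * ‖x‖ ^ 2 ≤ ‖∑' i, inner ℂ (b i) x • e i‖ ^ 2 := fun x =>
    le_of_tendsto_of_tendsto' ((hasSum_norm_inner_sq b x).const_mul α) (htend x) fun s => (h s _).1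
  let T₀ : E →ₗ[ℂ] H :=
    { toFun := fun x => ∑' i, inner ℂ (b i) x • e i
      map_add' := fun x y => by
        simp only [inner_add_right, add_smul]
        exact (hsum x).tsum_add (hsum y)
      map_smul' := fun c x => by
        simp only [inner_smul_right, mul_smul, RingHom.id_apply]
        exact (hsum x).tsum_const_smul c }
  refine ⟨T₀.mkContinuous √β fun x => ?_, fun x => (hsum x).hasSum, α, hα, hlow⟩
  refine le_of_sq_le_sq ?_ (by positivity)
  rw [mul_pow, Real.sq_sqrt hβ.le]
  exact hup x

/-- The synthesis operator of a Riesz sequence is an isomorphism onto its closed span: its range is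
closed, as it is bounded below. -/
theorem IsRieszSequence.exists_synthesisEquiv [CompleteSpace H] [CompleteSpace E] {e : ι → H}
    (he : IsRieszSequence e) (b : HilbertBasis ι ℂ E) :
    ∃ T : E ≃L[ℂ] (Submodule.span ℂ (Set.range e)).topologicalClosure,
      ∀ x, HasSum (fun i => inner ℂ (b i) x • e i) (T x : H) := by
  obtain ⟨T, hT, α, hα, hlow⟩ := he.exists_synthesis b
  have hanti : AntilipschitzWith (Real.toNNReal (√α)⁻¹) T :=
    T.antilipschitz_of_bound fun x => by
      rw [Real.coe_toNNReal _ (by positivity)]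
      have h1 : √α * ‖x‖ ≤ ‖T x‖ := by
        refine le_of_sq_le_sq ?_ (norm_nonneg _)
        rw [mul_pow, Real.sq_sqrt hα.le]
        exact hlow x
      rwa [inv_mul_eq_div, le_div_iff₀' (by positivity)]
  have hrange : LinearMap.range T.toLinearMap
      = (Submodule.span ℂ (Set.range e)).topologicalClosure := by
    refine le_antisymm ?_ ?_
    · rintro - ⟨x, rfl⟩
      refine mem_closure_of_tendsto (hT x) (Filter.Eventually.of_forall fun s => ?_)
      exact Submodule.sum_mem _ fun i _ =>
        Submodule.smul_mem _ _ (Submodule.subset_span ⟨i, rfl⟩)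
    · refine Submodule.topologicalClosure_minimal _ (Submodule.span_le.2 ?_)
        (hanti.isClosed_range T.uniformContinuous)
      rintro - ⟨i, rfl⟩
      refine ⟨b i, (hT (b i)).unique ?_⟩
      convert hasSum_single i ?_ using 1
      · simp [b.orthonormal.1 i]
      · intro j hj
        rw [b.orthonormal.2 hj, zero_smul]
  refine ⟨(T.equivRange hanti.injective (hanti.isClosed_range T.uniformContinuous)).trans
    (ContinuousLinearEquiv.ofEq _ _ hrange), hT⟩

/-- The image of a Hilbert basis under a bounded operator with a bounded right inverse on `V` is a
frame for `V`. -/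
theorem isFrameFor_of_rightInverse [CompleteSpace H] [CompleteSpace E] (b : HilbertBasis ι ℂ E)
    (V : Submodule ℂ H) (R : E →L[ℂ] H) (hR : ∀ x, R x ∈ V) (L : V →L[ℂ] E)
    (hL : ∀ f : V, R (L f) = f) : IsFrameFor V fun i => R (b i) := by
  -- Adding `1` to `‖L‖` keeps the bounds positive when `V` is trivial; adding the lower bound to the
  -- upper one makes them ordered.
  refine ⟨fun i => hR _, ((‖L‖ + 1) ^ 2)⁻¹, ((‖L‖ + 1) ^ 2)⁻¹ + ‖R.adjoint‖ ^ 2, by positivity,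
    le_add_of_nonneg_right (by positivity), fun f hf => ?_⟩
  have hs := hasSum_norm_inner_sq b (R.adjoint f)
  simp only [ContinuousLinearMap.adjoint_inner_right] at hs
  refine ⟨hs.summable, ?_, ?_⟩
  · rw [hs.tsum_eq, inv_mul_le_iff₀ (by positivity), ← mul_pow]
    refine pow_le_pow_left₀ (norm_nonneg _) ?_ 2
    have h1 : ‖f‖ * ‖f‖ ≤ ‖f‖ * ((‖L‖ + 1) * ‖R.adjoint f‖) :=
      calc ‖f‖ * ‖f‖ = ‖inner ℂ (L ⟨f, hf⟩) (R.adjoint f)‖ := by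
            rw [ContinuousLinearMap.adjoint_inner_right, hL, norm_inner_self_eq, sq]
        _ ≤ ‖L ⟨f, hf⟩‖ * ‖R.adjoint f‖ := norm_inner_le_norm _ _
        _ ≤ (‖L‖ * ‖f‖) * ‖R.adjoint f‖ := by
            gcongr
            exact L.le_opNorm ⟨f, hf⟩
        _ ≤ ((‖L‖ + 1) * ‖f‖) * ‖R.adjoint f‖ := by gcongr; simp
        _ = _ := by ring
    rcases (norm_nonneg f).eq_or_lt with h0 | h0
    · rw [← h0]
      positivity
    · exact le_of_mul_le_mul_left h1 h0
  · rw [hs.tsum_eq]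
    have h1 : ‖R.adjoint f‖ ^ 2 ≤ ‖R.adjoint‖ ^ 2 * ‖f‖ ^ 2 := by
      rw [← mul_pow]
      exact pow_le_pow_left₀ (norm_nonneg _) (R.adjoint.le_opNorm f) 2
    refine h1.trans ?_
    gcongr
    exact le_add_of_nonneg_left (by positivity)

/-- The coefficients of an expansion `f = ∑ c_i S_i` along a Bessel system `S` with bound `β` satisfy
`‖f‖² ≤ β ∑ |c_i|²`. -/
theorem norm_sq_le_of_hasSum_smul {S : ι → H} {c : ι → ℂ} {f : H} {β s : ℝ}
    (hβ0 : 0 ≤ β)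
    (hsum : Summable fun i => ‖inner ℂ (S i) f‖ ^ 2)
    (hβ : ∑' i, ‖inner ℂ (S i) f‖ ^ 2 ≤ β * ‖f‖ ^ 2)
    (hc : HasSum (fun i => ‖c i‖ ^ 2) s) (hf : HasSum (fun i => c i • S i) f) :
    ‖f‖ ^ 2 ≤ β * s := by
  have h1 : HasSum (fun i => inner ℂ f (c i • S i)) (inner ℂ f f) :=
    hf.mapL (innerSL ℂ f)
  have h2 : ‖inner ℂ f f‖ ^ 2 ≤ s * (β * ‖f‖ ^ 2) := by
    refine le_of_tendsto' (h1.norm.pow 2) fun t => ?_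
    calc ‖∑ i ∈ t, inner ℂ f (c i • S i)‖ ^ 2
        ≤ (∑ i ∈ t, ‖c i‖ * ‖inner ℂ (S i) f‖) ^ 2 := by
          refine pow_le_pow_left₀ (norm_nonneg _) ((norm_sum_le _ _).trans_eq ?_) 2
          refine Finset.sum_congr rfl fun i _ => ?_
          rw [inner_smul_right, norm_mul, norm_inner_symm]
      _ ≤ (∑ i ∈ t, ‖c i‖ ^ 2) * ∑ i ∈ t, ‖inner ℂ (S i) f‖ ^ 2 :=
          Finset.sum_mul_sq_le_sq_mul_sq _ _ _
      _ ≤ s * (β * ‖f‖ ^ 2) := by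
          refine mul_le_mul (sum_le_hasSum _ (fun _ _ => by positivity) hc)
            ((hsum.sum_le_tsum _ fun _ _ => by positivity).trans hβ)
            (Finset.sum_nonneg fun _ _ => by positivity) (hc.nonneg fun _ => by positivity)
  rw [norm_inner_self_eq] at h2
  rcases (norm_nonneg f).eq_or_lt with h0 | h0
  · have hs : 0 ≤ s := hc.nonneg fun _ => by positivity
    rw [← h0, zero_pow two_ne_zero]
    positivity
  · have h3 : ‖f‖ ^ 2 * ‖f‖ ^ 2 ≤ (β * s) * ‖f‖ ^ 2 := by
      nlinarith
    exact le_of_mul_le_mul_right h3 (by positivity)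

end Synthesis

section Coord

variable {G : Type*} {K : ℕ}

open scoped Classical in
/-- The vector of `ℓ²_K(G)` whose only nonzero entry is a `1` in position `(k, g)`. -/
def unitVec (p : Fin K × G) : EllTwoN G K :=
  WithLp.toLp 2 (Pi.single p.1 (lp.single 2 p.2 1))

theorem inner_toLp_single (k : Fin K) (w : EllTwo G) (x : EllTwoN G K) :
    inner ℂ x (WithLp.toLp 2 (Pi.single k w)) = inner ℂ (x k) w := by
  rw [PiLp.inner_apply, Finset.sum_eq_single k]
  · simp
  · intro i _ hi
    simp [hi]
  · simp

theorem inner_unitVec (p : Fin K × G) (x : EllTwoN G K) :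
    inner ℂ (unitVec p) x = x p.1 p.2 := by
  classical
  rw [← inner_conj_symm, unitVec, inner_toLp_single]
  rw [inner_conj_symm]
  convert lp.inner_single_left (𝕜 := ℂ) p.2 (1 : ℂ) (x p.1) using 1
  simp

variable (G K) in
theorem orthonormal_unitVec : Orthonormal ℂ (unitVec : Fin K × G → EllTwoN G K) := by
  classical
  rw [orthonormal_iff_ite]
  rintro ⟨i, g⟩ ⟨j, h⟩
  rw [inner_unitVec]
  by_cases hij : i = j
  · subst hij
    by_cases hgh : g = h
    · simp [unitVec, hgh]
    · simp [unitVec, hgh]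
  · simp [unitVec, hij]

variable (G K) in
/-- The canonical Hilbert basis of `ℓ²_K(G)`. -/
def unitBasis : HilbertBasis (Fin K × G) ℂ (EllTwoN G K) :=
  HilbertBasis.mkOfOrthogonalEqBot (orthonormal_unitVec G K) <| by
    rw [Submodule.eq_bot_iff]
    intro x hx
    refine PiLp.ext fun k => lp.ext (funext fun g => ?_)
    have h := (Submodule.mem_orthogonal _ x).1 hx (unitVec (k, g))
      (Submodule.subset_span ⟨_, rfl⟩)
    rwa [inner_unitVec] at h

@[simp]
theorem unitBasis_apply (p : Fin K × G) : unitBasis G K p = unitVec p := by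
  simp [unitBasis]

theorem hasSum_norm_coord_sq (x : EllTwoN G K) :
    HasSum (fun p : Fin K × G => ‖x p.1 p.2‖ ^ 2) (‖x‖ ^ 2) := by
  simpa [inner_unitVec] using hasSum_norm_inner_sq (unitBasis G K) x

theorem hasSum_coord_smul_unitVec (x : EllTwoN G K) :
    HasSum (fun p : Fin K × G => x p.1 p.2 • unitVec p) x := by
  simpa [HilbertBasis.repr_apply_apply, inner_unitVec] using (unitBasis G K).hasSum_repr x

end Coord

/-! ### Synthesis along the orbits of the representation -/

section Orbits

variable {G : Type*} [AddCommGroup G] {H : Type*} [NormedAddCommGroup H] [InnerProductSpace ℂ H]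
  {M N : ℕ} (U : Multiplicative G →* (H ≃ₗᵢ[ℂ] H)) (φ : Fin N → H)

theorem orbit_add (n : Fin N) (g h : G) :
    orbit U φ (n, g + h) = U (Multiplicative.ofAdd g) (orbit U φ (n, h)) := by
  simp [orbit, ofAdd_add]

variable {U φ} in
theorem IsSynthesis.translate {x : EllTwoN G N} {f : H} (hf : IsSynthesis U φ x f) (g : G) :
    HasSum (fun p : Fin N × G => x p.1 (p.2 - g) • orbit U φ p) (U (Multiplicative.ofAdd g) f) := by
  have h := (U (Multiplicative.ofAdd g)).toContinuousLinearEquiv.toContinuousLinearMap.hasSum hf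
  rw [← ((Equiv.refl (Fin N)).prodCongr (Equiv.addLeft g)).hasSum_iff]
  have h1 : ∀ p : Fin N × G, x p.1 (g + p.2 - g) • orbit U φ (p.1, g + p.2)
      = U (Multiplicative.ofAdd g) (x p.1 p.2 • orbit U φ p) := fun p => by
    rw [orbit_add, map_smul, add_sub_cancel_left]
  exact (congrArg (HasSum · _) (funext h1)).mpr h

variable {U φ} in
/-- The synthesis operator of the Riesz sequence `U(g) φ_n`, as an isomorphism of `ℓ²_N(G)` onto
`V_Φ`. -/
theorem exists_synthesisEquiv [CompleteSpace H] (hφ : IsRieszSequence (orbit U φ)) :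
    ∃ T : EllTwoN G N ≃L[ℂ] invSubspace U φ, ∀ x, IsSynthesis U φ x (T x) := by
  obtain ⟨T, hT⟩ := hφ.exists_synthesisEquiv (unitBasis G N)
  refine ⟨T, fun x => ?_⟩
  have h := hT x
  simp only [unitBasis_apply, inner_unitVec] at h
  exact h

variable {U φ} {T : EllTwoN G N ≃L[ℂ] invSubspace U φ}

theorem coeffs_synthesis (hT : ∀ x, IsSynthesis U φ x (T x)) (x : EllTwoN G N) :
    coeffs U φ (T x) = x := by
  have h : IsSynthesis U φ (coeffs U φ (T x)) (T x) :=
    Classical.epsilon_spec (p := fun y => IsSynthesis U φ y (T x)) ⟨x, hT x⟩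
  exact T.injective (Subtype.ext ((hT _).unique h))

variable [TopologicalSpace G] [DiscreteTopology G]

theorem samples_synthesis (hT : ∀ x, IsSynthesis U φ x (T x)) (A : EllTwoMatrix G M N)
    (hA : TransferBounded A) (x : EllTwoN G N) :
    samples U φ A (T x) = fun m => ⇑(convOp A hA x m) := by
  funext m g
  rw [samples, coeffs_synthesis hT, isConvolutionBy_convOp]

theorem convOp_unitVec (A : EllTwoMatrix G M N) (hA : TransferBounded A) (n : Fin N) (g : G)
    (m : Fin M) (h : G) : convOp A hA (unitVec (n, g)) m h = A m n (h - g) := by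
  classical
  rw [isConvolutionBy_convOp, matConv, Finset.sum_eq_single n, tsum_eq_single g]
  · simp [unitVec]
  · intro g' hg'
    simp [unitVec, hg']
  · intro i _ hi
    simp [unitVec, hi]
  · simp

/-- If `S_m` is synthesized from the `m`-th column of `B`, then `U(g) S_m` is synthesized from the
image under `B` of the unit vector in position `(m, g)`. -/
theorem orbit_eq_synthesis (hT : ∀ x, IsSynthesis U φ x (T x)) (B : EllTwoMatrix G N M)
    (hB : TransferBounded B) {S : Fin M → H}
    (hS : ∀ m, IsSynthesis U φ (WithLp.toLp 2 fun n => B n m) (S m)) (p : Fin M × G) :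
    orbit U S p = T (convOp B hB (unitVec p)) := by
  refine ((hS p.1).translate p.2).unique ?_
  refine (congrArg (HasSum · _) (funext fun q => ?_)).mp (hT (convOp B hB (unitVec p)))
  rw [convOp_unitVec]

theorem hasSum_smul_orbit (hT : ∀ x, IsSynthesis U φ x (T x)) (B : EllTwoMatrix G N M)
    (hB : TransferBounded B) {S : Fin M → H}
    (hS : ∀ m, IsSynthesis U φ (WithLp.toLp 2 fun n => B n m) (S m)) (y : EllTwoN G M) :
    HasSum (fun p : Fin M × G => y p.1 p.2 • orbit U S p) (T (convOp B hB y) : H) := by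
  have h := ((invSubspace U φ).subtypeL ∘L T.toContinuousLinearMap ∘L convOp B hB).hasSum
    (hasSum_coord_smul_unitVec y)
  simp only [orbit_eq_synthesis hT B hB hS]
  simpa using h

/-- The columns of a left inverse of `A` yield a reconstruction of the elements of `V_Φ` from their
samples. -/
theorem isReconstruction_of_leftInverse [CompleteSpace H] (hT : ∀ x, IsSynthesis U φ x (T x))
    (A : EllTwoMatrix G M N) (hA : TransferBounded A) (B : EllTwoMatrix G N M)
    (hB : TransferBounded B)
    (hBA : convOp B hB ∘L convOp A hA = ContinuousLinearMap.id ℂ (EllTwoN G N)) :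
    IsReconstruction U φ A fun m => T (WithLp.toLp 2 fun n => B n m) := by
  have hS : ∀ m, IsSynthesis U φ (WithLp.toLp 2 fun n => B n m)
      (T (WithLp.toLp 2 fun n => B n m) : H) := fun m => hT _
  refine ⟨fun m => Subtype.property _, ?_, fun f hf => ?_⟩
  · have h := isFrameFor_of_rightInverse (unitBasis G M) (invSubspace U φ)
      ((invSubspace U φ).subtypeL ∘L T.toContinuousLinearMap ∘L convOp B hB)
      (fun x => Subtype.property _) (convOp A hA ∘L T.symm.toContinuousLinearMap) fun f => by
        have h1 : convOp B hB (convOp A hA (T.symm f)) = T.symm f := DFunLike.congr_fun hBA _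
        simp [h1]
    convert h using 2 with p
    rw [unitBasis_apply]
    exact orbit_eq_synthesis hT B hB hS p
  · obtain ⟨x, hx⟩ := T.surjective ⟨f, hf⟩
    obtain rfl : (T x : H) = f := congrArg Subtype.val hx
    have h1 : convOp B hB (convOp A hA x) = x := DFunLike.congr_fun hBA _
    have h2 := hasSum_smul_orbit hT B hB hS (convOp A hA x)
    rw [h1] at h2
    rw [samples_synthesis hT A hA]
    exact h2

end Orbits

/-! ### Reconstruction systems come from left inverses -/

section Converse

variable {G : Type*} [AddCommGroup G]

theorem memℓp_translate (g : G) (a : EllTwo G) : Memℓp (fun h => a (h - g)) 2 := by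
  have h := (memℓp_gen_iff (by norm_num)).1 (lp.memℓp a)
  exact (memℓp_gen_iff (by norm_num)).2 ((Equiv.subRight g).summable_iff.2 h)

/-- The translate `h ↦ a (h - g)` of `a ∈ ℓ²(G)`. -/
def translate (g : G) (a : EllTwo G) : EllTwo G :=
  ⟨fun h => a (h - g), memℓp_translate g a⟩

variable [TopologicalSpace G] [DiscreteTopology G]

/-- If the translates of `a ∈ ℓ²(G)` form a Bessel system with bound `C`, then `|â|² ≤ C`. The Bessel
coefficients of `w` are the Fourier coefficients of `conj â ŵ`; taking for `ŵ` the indicator function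
of a measurable set gives the inequality integrated over that set. -/
theorem memLp_top_of_translates_bessel (a : EllTwo G) {C : ℝ}
    (h : ∀ (w : EllTwo G) (s : Finset G),
      ∑ g ∈ s, ‖∑' g', conj (a (g' - g)) * w g'‖ ^ 2 ≤ C * ‖w‖ ^ 2) :
    MemLp (fourierL2 G a) ∞ (dualHaar G) := by
  -- `a'` is the involution of `a`, so that convolution by `a'` computes the Bessel coefficients.
  set a' := (fourierEquiv G).symm (memLp_fourierL2 a).star.toLp with ha'
  have ha1 : fourierL2 G a' =ᵐ[dualHaar G] fun ξ => conj (fourierL2 G a ξ) := by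
    rw [ha', fourierL2_symm_apply]
    exact (memLp_fourierL2 a).star.coeFn_toLp
  have ha2 : ∀ g, a' g = conj (a (-g)) := fun g => by
    rw [← integral_pairing_mul_fourierL2, ← integral_pairing_mul_fourierL2, ← integral_conj]
    refine integral_congr_ae ?_
    filter_upwards [ha1] with ξ hξ
    rw [hξ, map_mul, conj_pairing, neg_neg]
  have hint : Integrable (fun ξ => C - ‖fourierL2 G a ξ‖ ^ 2) (dualHaar G) :=
    (integrable_const C).sub (integrable_norm_fourierL2_sq a)
  have hpos := ae_nonneg_of_forall_setIntegral_nonneg hint fun E hE _ => by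
    have hw : MemLp (E.indicator fun _ => (1 : ℂ)) 2 (dualHaar G) := (memLp_const 1).indicator hE
    have hu : MemLp (E.indicator fun ξ => conj (fourierL2 G a ξ)) 2 (dualHaar G) :=
      (memLp_fourierL2 a).star.indicator hE
    set w := (fourierEquiv G).symm (hw.toLp _) with hw'
    set u := (fourierEquiv G).symm (hu.toLp _) with hu'
    have hw1 : fourierL2 G w =ᵐ[dualHaar G] E.indicator fun _ => (1 : ℂ) := by
      rw [hw', fourierL2_symm_apply]
      exact hw.coeFn_toLp
    have hu1 : fourierL2 G u =ᵐ[dualHaar G] E.indicator fun ξ => conj (fourierL2 G a ξ) := by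
      rw [hu', fourierL2_symm_apply]
      exact hu.coeFn_toLp
    have hug : ∀ g, ∑' g', conj (a (g' - g)) * w g' = u g := fun g => by
      have h1 := (hasSum_convolution a' w g).tsum_eq
      simp only [ha2, neg_sub] at h1
      rw [h1, ← integral_pairing_mul_fourierL2]
      refine integral_congr_ae ?_
      filter_upwards [ha1, hw1, hu1] with ξ h1 h2 h3
      rw [h1, h2, h3]
      by_cases hξ : ξ ∈ E <;> simp [hξ]
    have hle : ‖u‖ ^ 2 ≤ C * ‖w‖ ^ 2 := by
      have hs : HasSum (fun g => ‖u g‖ ^ 2) (‖u‖ ^ 2) := by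
        simpa using lp.hasSum_norm (p := 2) (by norm_num) u
      refine hasSum_le_of_sum_le hs fun s => ?_
      have := h w s
      simpa only [hug] using this
    rw [norm_fourierL2_sq, norm_fourierL2_sq] at hle
    have h2 : ∫ ξ, ‖fourierL2 G u ξ‖ ^ 2 ∂(dualHaar G)
        = ∫ ξ in E, ‖fourierL2 G a ξ‖ ^ 2 ∂(dualHaar G) := by
      rw [← integral_indicator hE]
      refine integral_congr_ae ?_
      filter_upwards [hu1] with ξ hξ
      rw [hξ]
      by_cases hξ : ξ ∈ E <;> simp [hξ]
    have h3 : ∫ ξ, ‖fourierL2 G w ξ‖ ^ 2 ∂(dualHaar G) = ∫ _ξ in E, (1 : ℝ) ∂(dualHaar G) := by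
      rw [← integral_indicator hE]
      refine integral_congr_ae ?_
      filter_upwards [hw1] with ξ hξ
      rw [hξ]
      by_cases hξ : ξ ∈ E <;> simp [hξ]
    rw [h2, h3, ← integral_const_mul, mul_one] at hle
    rw [integral_sub (integrable_const C).integrableOn
      (integrable_norm_fourierL2_sq a).integrableOn]
    exact sub_nonneg.2 hle
  refine memLp_top_of_bound (memLp_fourierL2 a).1 √C ?_
  filter_upwards [hpos] with ξ hξ
  exact Real.le_sqrt_of_sq_le (sub_nonneg.1 hξ)

variable {H : Type*} [NormedAddCommGroup H] [InnerProductSpace ℂ H] [CompleteSpace H]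
  {M N : ℕ} {U : Multiplicative G →* (H ≃ₗᵢ[ℂ] H)} {φ : Fin N → H}
  {T : EllTwoN G N ≃L[ℂ] invSubspace U φ}

/-- If the orbits `U(g) S_m` form a frame for `V_Φ`, the coefficient matrix of the `S_m` has a bounded
transfer matrix. The elements of `V_Φ` are paired with the frame through the adjoint of the inverse
of the synthesis operator, which turns inner products in `V_Φ` into inner products of
coefficients. -/
theorem transferBounded_of_isFrameFor (hT : ∀ x, IsSynthesis U φ x (T x)) {S : Fin M → H}
    (hframe : IsFrameFor (invSubspace U φ) (orbit U S)) (B : EllTwoMatrix G N M)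
    (hS : ∀ m, IsSynthesis U φ (WithLp.toLp 2 fun n => B n m) (S m)) : TransferBounded B := by
  obtain ⟨hmem, α, β, hα, hαβ, hβ⟩ := hframe
  have : CompleteSpace (invSubspace U φ) :=
    (Submodule.isClosed_topologicalClosure _).completeSpace_coe
  let R : EllTwoN G N →L[ℂ] invSubspace U φ := T.symm.toContinuousLinearMap.adjoint
  have hR : ∀ (x z : EllTwoN G N), inner ℂ (T x : H) (R z : H) = inner ℂ x z := fun x z => by
    rw [← Submodule.coe_inner, ContinuousLinearMap.adjoint_inner_right]
    simp
  -- The coefficients of `U(g) S_m` are the translates by `g` of those of `S_m`.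
  have hcoef : ∀ p n h, T.symm ⟨orbit U S p, hmem p⟩ n h = B n p.1 (h - p.2) := by
    intro p n h
    set y : EllTwoN G N := WithLp.toLp 2 fun n => translate p.2 (B n p.1) with hy
    have h1 : T y = ⟨orbit U S p, hmem p⟩ :=
      Subtype.ext ((hT y).unique ((hS p.1).translate p.2))
    rw [← h1, ContinuousLinearEquiv.symm_apply_apply]
    rfl
  intro n m
  refine memLp_top_of_translates_bessel (B n m) (C := β * ‖R‖ ^ 2) fun w s => ?_
  set z : EllTwoN G N := WithLp.toLp 2 (Pi.single n w) with hz
  have hzn : ‖z‖ = ‖w‖ := PiLp.norm_single 2 (fun _ : Fin N => EllTwo G) n w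
  have hin : ∀ g, inner ℂ (orbit U S (m, g)) (R z : H) = ∑' g', conj (B n m (g' - g)) * w g' :=
    fun g => by
      have h1 := hR (T.symm ⟨orbit U S (m, g), hmem _⟩) z
      rw [ContinuousLinearEquiv.apply_symm_apply, hz, inner_toLp_single, lp.inner_eq_tsum] at h1
      rw [h1]
      refine tsum_congr fun g' => ?_
      rw [hcoef, RCLike.inner_apply, mul_comm]
  obtain ⟨h1, -, h2⟩ := hβ (R z) (Subtype.property _)
  calc ∑ g ∈ s, ‖∑' g', conj (B n m (g' - g)) * w g'‖ ^ 2
      = ∑ p ∈ s.map (Function.Embedding.sectR m G), ‖inner ℂ (orbit U S p) (R z : H)‖ ^ 2 := by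
        simp [hin]
    _ ≤ β * ‖(R z : H)‖ ^ 2 := (h1.sum_le_tsum _ fun _ _ => by positivity).trans h2
    _ ≤ β * (‖R‖ * ‖w‖) ^ 2 := by
        have : ‖(R z : H)‖ ≤ ‖R‖ * ‖w‖ := hzn ▸ R.le_opNorm z
        have hβ0 : 0 ≤ β := hα.le.trans hαβ
        gcongr
    _ = β * ‖R‖ ^ 2 * ‖w‖ ^ 2 := by ring

end Converse

end ConvSampling

end

/-! ### Equivalent conditions for stable reconstruction -/

theorem mainTheorem1
    {G : Type*} [AddCommGroup G] [Countable G] [TopologicalSpace G] [DiscreteTopology G]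
    {H : Type*} [NormedAddCommGroup H] [InnerProductSpace ℂ H] [CompleteSpace H]
    [TopologicalSpace.SeparableSpace H]
    (U : Multiplicative G →* (H ≃ₗᵢ[ℂ] H)) {M N : ℕ} (φ : Fin N → H)
    (hφ : IsRieszSequence (orbit U φ))
    (A : EllTwoMatrix G M N) (hA : TransferBounded A) :
    [ -- (a)
      0 < essInf (fun ξ => ((transfer A ξ)ᴴ * transfer A ξ).det.re) (dualHaar G),
      -- (b)
      ∃ α β : ℝ, 0 < α ∧ α ≤ β ∧ ∀ f ∈ invSubspace U φ,
        Summable (fun p : Fin M × G => ‖samples U φ A f p.1 p.2‖ ^ 2) ∧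
        α * ‖f‖ ^ 2 ≤ ∑' p : Fin M × G, ‖samples U φ A f p.1 p.2‖ ^ 2 ∧
        ∑' p : Fin M × G, ‖samples U φ A f p.1 p.2‖ ^ 2 ≤ β * ‖f‖ ^ 2,
      -- (c)
      ∃ B : Matrix (Fin N) (Fin M) (Lp ℂ ∞ (dualHaar G)),
        ∀ᵐ ξ ∂(dualHaar G), (Matrix.of fun n m => B n m ξ) * transfer A ξ = 1,
      -- (d), in terms of the elements of the subspace
      ∃ B : EllTwoMatrix G N M, TransferBounded B ∧ ∀ f ∈ invSubspace U φ,
        (∀ n g, coeffs U φ f n g = matConv B (samples U φ A f) n g) ∧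
        IsSynthesis U φ (coeffs U φ f) f,
      -- (d), in terms of convolution systems
      ∃ (opA : EllTwoN G N →L[ℂ] EllTwoN G M) (opB : EllTwoN G M →L[ℂ] EllTwoN G N),
        IsConvolutionBy opA A ∧ IsBoundedConvolutionSystem opB ∧
        opB ∘L opA = ContinuousLinearMap.id ℂ (EllTwoN G N),
      -- (e)
      ∃ S : Fin M → H, IsReconstruction U φ A S,
      -- (f)
      ∃ S : Fin M × G → H, IsFrameFor (invSubspace U φ) S ∧ ∀ f ∈ invSubspace U φ,
        HasSum (fun p : Fin M × G => samples U φ A f p.1 p.2 • S p) f ].TFAE ∧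
    -- the reconstruction elements necessarily come from the columns of a left inverse
    ∀ S : Fin M → H, IsReconstruction U φ A S →
      ∃ B : EllTwoMatrix G N M, TransferBounded B ∧
        (∀ᵐ ξ ∂(dualHaar G), transfer B ξ * transfer A ξ = 1) ∧
        ∀ m, IsSynthesis U φ (WithLp.toLp 2 fun n => B n m) (S m) := by

  obtain ⟨T, hT⟩ := exists_synthesisEquiv hφ
  have hTsurj : ∀ f ∈ invSubspace U φ, ∃ x, (T x : H) = f := fun f hf =>
    ⟨T.symm ⟨f, hf⟩, by simp⟩
  have hsamp : ∀ x, HasSum (fun p : Fin M × G => ‖samples U φ A (T x) p.1 p.2‖ ^ 2)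
      (‖convOp A hA x‖ ^ 2) := fun x => by
    rw [samples_synthesis hT A hA]
    exact hasSum_norm_coord_sq (convOp A hA x)
  have hxT : ∀ x, ‖x‖ ≤ ‖T.symm.toContinuousLinearMap‖ * ‖(T x : H)‖ := fun x => by
    simpa using T.symm.toContinuousLinearMap.le_opNorm (T x)
  constructor
  · tfae_have 1 → 3 := by
      intro h
      obtain ⟨δ, hδ, hdet⟩ := (essInf_det_transfer_pos_iff A hA).1 h
      obtain ⟨F, hF, hFA⟩ := exists_bounded_left_inverse hA hδ hdet
      refine ⟨Matrix.of fun n m => (hF n m).toLp, ?_⟩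
      have h1 : ∀ᵐ ξ ∂(dualHaar G), ∀ n m, (hF n m).toLp _ ξ = F ξ n m :=
        ae_all_iff.2 fun n => ae_all_iff.2 fun m => (hF n m).coeFn_toLp
      filter_upwards [hFA, h1] with ξ h2 h3
      rw [← h2]
      congr 1
      ext n m
      exact h3 n m
    tfae_have 3 → 5 := by
      rintro ⟨F, hF⟩
      obtain ⟨B, hB, hBF⟩ := exists_transfer_eq (fun ξ => Matrix.of fun n m => F n m ξ)
        fun n m => Lp.memLp (F n m)
      refine ⟨convOp A hA, convOp B hB, isConvolutionBy_convOp A hA,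
        ⟨B, hB, isConvolutionBy_convOp B hB⟩, (convOp_comp_eq_id_iff A hA B hB).2 ?_⟩
      filter_upwards [hF, hBF] with ξ h1 h2
      rw [h2, h1]
    tfae_have 5 → 4 := by
      rintro ⟨opA, opB, hopA, ⟨B, hB, hopB⟩, hBA⟩
      refine ⟨B, hB, fun f hf => ?_⟩
      obtain ⟨x, rfl⟩ := hTsurj f hf
      rw [coeffs_synthesis hT, samples_synthesis hT A hA, ← hopA.eq_convOp hA]
      refine ⟨fun n g => ?_, hT x⟩
      rw [← hopB]
      exact congrArg (fun y : EllTwoN G N => y n g) (DFunLike.congr_fun hBA x).symm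
    tfae_have 4 → 6 := by
      rintro ⟨B, hB, hrec⟩
      refine ⟨_, isReconstruction_of_leftInverse hT A hA B hB ?_⟩
      ext x n g
      have h := (hrec (T x) (T x).2).1 n g
      rw [coeffs_synthesis hT, samples_synthesis hT A hA] at h
      exact (isConvolutionBy_convOp B hB _ n g).trans h.symm
    tfae_have 6 → 7 := fun ⟨S, hS⟩ => ⟨orbit U S, hS.2⟩
    tfae_have 7 → 2 := by
      rintro ⟨S, ⟨-, α, β, hα, hαβ, hS⟩, hrec⟩
      have hβ : 0 < β := hα.trans_le hαβ
      refine ⟨β⁻¹, β⁻¹ + (‖convOp A hA‖ * ‖T.symm.toContinuousLinearMap‖) ^ 2, inv_pos.2 hβ,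
        le_add_of_nonneg_right (by positivity), fun f hf => ?_⟩
      obtain ⟨x, rfl⟩ := hTsurj f hf
      refine ⟨(hsamp x).summable, ?_, ?_⟩
      · rw [(hsamp x).tsum_eq, inv_mul_le_iff₀ hβ]
        obtain ⟨h1, -, h2⟩ := hS _ hf
        exact norm_sq_le_of_hasSum_smul hβ.le h1 h2 (hsamp x) (hrec _ hf)
      · rw [(hsamp x).tsum_eq]
        have h1 : ‖convOp A hA x‖
            ≤ ‖convOp A hA‖ * ‖T.symm.toContinuousLinearMap‖ * ‖(T x : H)‖ := by
          rw [mul_assoc]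
          exact ((convOp A hA).le_opNorm x).trans
            (mul_le_mul_of_nonneg_left (hxT x) (norm_nonneg _))
        calc ‖convOp A hA x‖ ^ 2
            ≤ (‖convOp A hA‖ * ‖T.symm.toContinuousLinearMap‖) ^ 2 * ‖(T x : H)‖ ^ 2 := by
              rw [← mul_pow]
              exact pow_le_pow_left₀ (norm_nonneg _) h1 2
          _ ≤ _ := by
              gcongr
              exact le_add_of_nonneg_left (inv_pos.2 hβ).le
    tfae_have 2 → 1 := by
      rintro ⟨α, β, hα, -, h⟩
      set γ := ‖T.symm.toContinuousLinearMap‖ + 1 with hγ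
      have hγ0 : 0 < γ := by positivity
      have hlow : ∀ x, α / γ ^ 2 * ‖x‖ ^ 2 ≤ ‖convOp A hA x‖ ^ 2 := fun x => by
        obtain ⟨-, h1, -⟩ := h (T x) (T x).2
        rw [(hsamp x).tsum_eq] at h1
        have h2 : ‖x‖ ≤ γ * ‖(T x : H)‖ :=
          (hxT x).trans (mul_le_mul_of_nonneg_right (le_add_of_nonneg_right zero_le_one)
            (norm_nonneg _))
        calc α / γ ^ 2 * ‖x‖ ^ 2 ≤ α / γ ^ 2 * (γ * ‖(T x : H)‖) ^ 2 := by gcongr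
          _ = α * ‖(T x : H)‖ ^ 2 := by field_simp
          _ ≤ _ := h1
      refine (essInf_det_transfer_pos_iff A hA).2 ⟨(α / γ ^ 2) ^ N, by positivity, ?_⟩
      filter_upwards [transfer_bounded_below A hA hlow] with ξ hξ
      exact pow_le_det_conjTranspose_mul_self _ (by positivity) hξ
    tfae_finish
  · rintro S ⟨hSV, hframe, hrec⟩
    choose b hb using fun m => hTsurj (S m) (hSV m)
    have hS : ∀ m, IsSynthesis U φ (b m) (S m) := fun m => hb m ▸ hT (b m)
    have hB : TransferBounded (Matrix.of fun n m => b m n) :=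
      transferBounded_of_isFrameFor hT hframe _ hS
    refine ⟨Matrix.of fun n m => b m n, hB, (convOp_comp_eq_id_iff A hA _ hB).1 ?_, hS⟩
    ext1 x
    have h1 := hrec (T x) (T x).2
    rw [samples_synthesis hT A hA] at h1
    exact T.injective (Subtype.ext ((hasSum_smul_orbit hT _ hB hS (convOp A hA x)).unique h1))
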